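/- Let $c>0$ and let $\mathcal K(k,k')=-\frac1\pi\,\frac{c}{c^2+(k-k')^2}$ be the kernel of the repulsive Lieb--Liniger gas. For a real function $\theta\in L^2(\mathbb R)$, the dressing operator $U=U[\theta]$ is the inverse of $1+\mathcal K\theta$ on the space of continuous functions on $\mathbb R$ of at most linear growth; that is, $Q=Uf$, also written $Q(k)=\int U(k,k')f(k')\,dk'$, is the unique such function with $$Q(k)+\int_{\mathbb R}\mathcal K(k,k')\,\theta(k')\,Q(k')\,dk'=f(k)\qquad(k\in\mathbb R).$$ The integro-differential Bethe--Boltzmann equation is $\partial_t\theta(x,t,k)+v[\theta](k)\,\partial_x\theta(x,t,k)=0$, with velocity $$v[\theta](k)=\frac{\int U(k,k')\,k'\,dk'}{\int U(k,k')\,dk'} .$$ For a functional $F$ defined near $\theta\in L^2(\mathbb R)$, the functional derivative $k\mapsto\delta F/\delta\theta(k)$ exists at $\theta$ if $F$ is Fréchet differentiable at $\theta$ and its $L^2$-gradient has a continuous representative, which is then $\delta F/\delta\theta(\cdot)$. Proposition. There is an open neighbourhood $\mathcal A$ of $0$ in $L^2(\mathbb R)$ such that for every $\theta\in\mathcal A$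 the dressing operator exists, $\int U(k,k')\,dk'>0$ for all $k$, and $v[\theta](k)\ne v[\theta](k')$ whenever $k\neq k'$, and such that the velocity has the continuum WNS (weakly non-linear semi-Hamiltonian) property on $\mathcal A$: for every $\theta\in\mathcal A$ the functional derivatives below exist, and 1. $\displaystyle \frac{\delta v(k)}{\delta\theta(k)}=0$ for all $k\in\mathbb R$, i.e. the functional derivative of $\theta\mapsto v[\theta](k)$ vanishes at the point $k$; 2. for all $k,k',k''\in\mathbb R$ with $k\neq k'\neq k''\neq k$, $$\frac{\delta}{\delta\theta(k'')}\left[\frac{1}{v(k')-v(k)}\frac{\delta v(k)}{\delta\theta(k')}\right]=\frac{\delta}{\delta\theta(k')}\left[\frac{1}{v(k'')-v(k)}\frac{\delta v(k)}{\delta\theta(k'')}\right].$$ -/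

import Mathlib

open MeasureTheory

namespace BetheBoltzmann

/-- The target space `L²(ℝ)` of real Fermi factors `k ↦ θ(k)`. -/
abbrev TargetSpace : Type := Lp ℝ 2 (volume : Measure ℝ)

/-- The kernel of the repulsive Lieb-Liniger gas with coupling `c > 0`,
`𝒦(k, k') = -(1/π) c / (c² + (k - k')²)`. -/
noncomputable def liebLinigerKernel (c k k' : ℝ) : ℝ :=
  -(1 / Real.pi) * (c / (c ^ 2 + (k - k') ^ 2))

/-- Continuous functions of at most linear growth. This is the space on which the dressing
operator acts; it contains the two bare functions `k ↦ 1` and `k ↦ k`. -/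
def LinearGrowth (f : ℝ → ℝ) : Prop :=
  Continuous f ∧ ∃ C : ℝ, ∀ k, |f k| ≤ C * (1 + |k|)

/-- `Q` solves the dressing equation
`Q(k) + ∫ 𝒦(k, k') θ(k') Q(k') dk' = f(k)` for all `k`, in the class of continuous functions of
at most linear growth. -/
def IsDressed (c : ℝ) (θ : TargetSpace) (f Q : ℝ → ℝ) : Prop :=
  LinearGrowth Q ∧ ∀ k, Q k + ∫ k', liebLinigerKernel c k k' * θ k' * Q k' = f k

/-- The dressing operator `U = (1 + 𝒦θ)⁻¹` exists at `θ`: the operator `1 + 𝒦θ` is invertible on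
the continuous functions of at most linear growth. -/
def DressingExists (c : ℝ) (θ : TargetSpace) : Prop :=
  ∀ f, LinearGrowth f → ∃! Q, IsDressed c θ f Q

open Classical in
/-- The dressed function `(U f)(k) = ∫ U(k, k') f(k') dk'`, where
`U(k, k') + ∫ 𝒦(k, k'') θ(k'') U(k'', k') dk'' = δ(k - k')`.
(The value `0` is used if there is no solution.) -/
noncomputable def dress (c : ℝ) (θ : TargetSpace) (f : ℝ → ℝ) : ℝ → ℝ :=
  if h : ∃ Q, IsDressed c θ f Q then h.choose else 0

/-- The dressed derivative of momentum, `P'(k) = ∫ U(k, k') dk'`. -/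
noncomputable def dressedMomentum (c : ℝ) (θ : TargetSpace) : ℝ → ℝ :=
  dress c θ fun _ => 1

/-- The dressed derivative of energy, `E'(k) = ∫ U(k, k') k' dk'`. -/
noncomputable def dressedEnergy (c : ℝ) (θ : TargetSpace) : ℝ → ℝ :=
  dress c θ fun k => k

/-- The quasiparticle velocity `v[θ](k) = ∫ U(k, k') k' dk' / ∫ U(k, k') dk'`. -/
noncomputable def velocity (c : ℝ) (θ : TargetSpace) (k : ℝ) : ℝ :=
  dressedEnergy c θ k / dressedMomentum c θ k

/-- `g` is the functional derivative `k ↦ δF/δθ(k)` of `F` at `θ`: `F` is Fréchet differentiable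
at `θ`, its differential is `h ↦ ∫ g(k) h(k) dk`, and `g` is the continuous representative
of this `L²` gradient, so that its values at points are meaningful. -/
def HasFunctionalDerivAt (F : TargetSpace → ℝ) (g : ℝ → ℝ) (θ : TargetSpace) : Prop :=
  Continuous g ∧ ∃ hg : MemLp g 2 (volume : Measure ℝ), HasGradientAt F (hg.toLp g) θ

theorem HasFunctionalDerivAt.unique {F : TargetSpace → ℝ} {g₁ g₂ : ℝ → ℝ} {θ : TargetSpace}
    (h₁ : HasFunctionalDerivAt F g₁ θ) (h₂ : HasFunctionalDerivAt F g₂ θ) : g₁ = g₂ := by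
  obtain ⟨c₁, m₁, d₁⟩ := h₁
  obtain ⟨c₂, m₂, d₂⟩ := h₂
  have h := d₁.unique d₂
  rw [MemLp.toLp_eq_toLp_iff] at h
  exact (Continuous.ae_eq_iff_eq volume c₁ c₂).1 h

/-- The functional derivative of `F` exists at `θ`. -/
def FunctionallyDifferentiableAt (F : TargetSpace → ℝ) (θ : TargetSpace) : Prop :=
  ∃ g, HasFunctionalDerivAt F g θ

open Classical in
/-- The functional derivative `k ↦ δF/δθ(k)` at `θ` (`0` if it does not exist). -/
noncomputable def functionalDeriv (F : TargetSpace → ℝ) (θ : TargetSpace) : ℝ → ℝ :=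
  if h : FunctionallyDifferentiableAt F θ then h.choose else 0

theorem HasFunctionalDerivAt.functionalDeriv_eq {F : TargetSpace → ℝ} {g : ℝ → ℝ}
    {θ : TargetSpace} (h : HasFunctionalDerivAt F g θ) : functionalDeriv F θ = g := by
  have h' : FunctionallyDifferentiableAt F θ := ⟨g, h⟩
  rw [functionalDeriv, dif_pos h']
  exact h'.choose_spec.unique h

/-- The continuum Christoffel-type coefficient
`(1 / (v(k') - v(k))) δv(k)/δθ(k')`, as a functional of `θ`. -/
noncomputable def tsarevCoeff (c k k' : ℝ) (θ : TargetSpace) : ℝ :=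
  1 / (velocity c θ k' - velocity c θ k) *
    functionalDeriv (fun ϑ => velocity c ϑ k) θ k'

end BetheBoltzmann

/-! Write `φ` for the Cauchy density, so that dressing solves `Q = f + ∫ φ(k - u) θ(u) Q(u) du`. Let
`P` and `E` be the dressings of `1` and of the identity, and let `R_k` be the dressing of `φ(· -
k)`. Linearising the equation in `θ` gives `δ(Uf)(k)/δθ(u) = R_k(u) (Uf)(u)`
(`hasFunctionalDerivAt_dress`). For `v = E / P` this yields `δv(k)/δθ(u) = (v(u) - v(k)) R_k(u) P(u)
/ P(k)`, which vanishes at `u = k`, and the coefficient in the second condition becomes `R_k(k')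
P(k') / P(k)`. Since `R_k` is itself a dressed function, the same rule gives `δR_k(k')/δθ(u) =
R_k'(u) R_k(u)`. The derivative of the coefficient is then explicit, and it is symmetric in `k',
k''` because `R_k(l) = R_l(k)` (`dressedKernel_symm`), a consequence of `φ` being even.

The analysis is a Neumann series in sup norms weighted by `1`, `1 + |u - l|` and `φ(u - l)`, with
one constant `A` for all three weights and all `l` (`exists_dressingWeight`). The first weight keeps
`P` near `1`, the second carries the linear-growth class, and the third gives `R_k` the decay needed
for Fubini and for gradients in `L²`. Uniformity in `l` also makes `v` strictly increasing for small
`θ`. -/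

namespace BetheBoltzmann

/-- The Cauchy density `x ↦ (1/π) c / (c² + x²)`; the Lieb-Liniger kernel is
`𝒦(k, k') = -cauchyKernel c (k - k')`. -/
noncomputable def cauchyKernel (c x : ℝ) : ℝ := 1 / Real.pi * (c / (c ^ 2 + x ^ 2))

theorem liebLinigerKernel_eq (c k u : ℝ) : liebLinigerKernel c k u = -cauchyKernel c (k - u) := by
  simp [liebLinigerKernel, cauchyKernel]

theorem cauchyKernel_neg (c x : ℝ) : cauchyKernel c (-x) = cauchyKernel c x := by
  simp [cauchyKernel]

theorem cauchyKernel_sub_comm (c x y : ℝ) : cauchyKernel c (x - y) = cauchyKernel c (y - x) := by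
  rw [← neg_sub, cauchyKernel_neg]

/-! ### Estimates for the Cauchy kernel and admissible weights -/

section

variable {c : ℝ} (hc : 0 < c)
include hc

theorem cauchyKernel_pos (x : ℝ) : 0 < cauchyKernel c x := by
  have := Real.pi_pos
  unfold cauchyKernel
  positivity

theorem continuous_cauchyKernel : Continuous (cauchyKernel c) := by
  unfold cauchyKernel
  refine continuous_const.mul (continuous_const.div (by fun_prop) fun x => ?_)
  positivity

/-- After clearing denominators this is `(a + b)² ≤ 2 (a² + b²)` with room to spare. It makes `φ(· -
l)` an admissible weight. -/
theorem cauchyKernel_mul_le (a b : ℝ) :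
    cauchyKernel c a * cauchyKernel c b ≤
      2 * cauchyKernel c (a + b) * (cauchyKernel c a + cauchyKernel c b) := by
  have hpi := Real.pi_pos
  unfold cauchyKernel
  have e : 2 * (1 / Real.pi * (c / (c ^ 2 + (a + b) ^ 2))) *
        (1 / Real.pi * (c / (c ^ 2 + a ^ 2)) + 1 / Real.pi * (c / (c ^ 2 + b ^ 2))) -
      1 / Real.pi * (c / (c ^ 2 + a ^ 2)) * (1 / Real.pi * (c / (c ^ 2 + b ^ 2))) =
      c ^ 2 * (3 * c ^ 2 + (a - b) ^ 2) / (Real.pi ^ 2 * (c ^ 2 + a ^ 2) * (c ^ 2 + b ^ 2) *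
        (c ^ 2 + (a + b) ^ 2)) := by
    have h1 : c ^ 2 + a ^ 2 ≠ 0 := by positivity
    have h2 : c ^ 2 + b ^ 2 ≠ 0 := by positivity
    have h3 : c ^ 2 + (a + b) ^ 2 ≠ 0 := by positivity
    field_simp
    ring
  have : 0 ≤ c ^ 2 * (3 * c ^ 2 + (a - b) ^ 2) / (Real.pi ^ 2 * (c ^ 2 + a ^ 2) *
      (c ^ 2 + b ^ 2) * (c ^ 2 + (a + b) ^ 2)) := by positivity
  linarith

/-- The Lipschitz factor is expressed through `φ` itself, so increments of the convolution inherit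
the weighted bounds of its values. -/
theorem abs_cauchyKernel_sub_le (a b : ℝ) :
    |cauchyKernel c a - cauchyKernel c b| ≤
      1 / (2 * c) * |a - b| * (cauchyKernel c a + cauchyKernel c b) := by
  have hpi := Real.pi_pos
  have h1 : 0 < c ^ 2 + a ^ 2 := by positivity
  have h2 : 0 < c ^ 2 + b ^ 2 := by positivity
  have e : cauchyKernel c a - cauchyKernel c b =
      c / (Real.pi * (c ^ 2 + a ^ 2) * (c ^ 2 + b ^ 2)) * ((b - a) * (a + b)) := by
    unfold cauchyKernel
    field_simp
    ring
  have e' : 1 / (2 * c) * |a - b| * (cauchyKernel c a + cauchyKernel c b) =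
      c / (Real.pi * (c ^ 2 + a ^ 2) * (c ^ 2 + b ^ 2)) *
        (|a - b| * ((2 * c ^ 2 + a ^ 2 + b ^ 2) / (2 * c))) := by
    unfold cauchyKernel
    field_simp
    ring
  rw [e, e', abs_mul, abs_mul, abs_of_pos (a := c / _) (by positivity), abs_sub_comm b a]
  gcongr
  rw [le_div_iff₀ (by positivity)]
  nlinarith [sq_nonneg (2 * c - |a + b|), sq_abs (a + b), sq_nonneg (a - b)]

/-- A weight `w` is admissible with constant `A` if `θ ↦ 𝒦θ` is bounded with norm at most `A‖θ‖`
on the continuous functions of size `O(w)`. -/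
structure DressingWeight (c A : ℝ) (w : ℝ → ℝ) : Prop where
  continuous : Continuous w
  pos : ∀ u, 0 < w u
  integrable : ∀ (θ : TargetSpace) k, Integrable fun u => cauchyKernel c (k - u) * w u * |θ u|
  bound : ∀ (θ : TargetSpace) k,
    ∫ u, cauchyKernel c (k - u) * w u * |θ u| ≤ A * ‖θ‖ * w k

/-- Decay like `1 / |x|` suffices for `L²`. This controls linear growth both in Cauchy–Schwarz
against `θ` and in the gradients. -/
theorem memLp_cauchyKernel_mul_one_add_abs :
    MemLp (fun x => cauchyKernel c x * (1 + |x|)) 2 := by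
  have hcont : Continuous fun x => cauchyKernel c x * (1 + |x|) :=
    (continuous_cauchyKernel hc).mul (by fun_prop)
  rw [memLp_two_iff_integrable_sq hcont.aestronglyMeasurable]
  have hpi := Real.pi_pos
  have hint : Integrable fun x : ℝ => (1 + (x / c) ^ 2)⁻¹ :=
    integrable_inv_one_add_sq.comp_div hc.ne'
  refine (hint.const_mul (2 * (1 + c ^ 2) / (Real.pi ^ 2 * c ^ 2))).mono'
    (hcont.pow 2).aestronglyMeasurable (.of_forall fun x => ?_)
  rw [Real.norm_of_nonneg (by positivity)]
  have hx : 0 < c ^ 2 + x ^ 2 := by positivity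
  have e1 : (cauchyKernel c x * (1 + |x|)) ^ 2 =
      c ^ 2 * (1 + |x|) ^ 2 / (Real.pi ^ 2 * (c ^ 2 + x ^ 2) ^ 2) := by
    unfold cauchyKernel
    field_simp
  have e2 : 2 * (1 + c ^ 2) / (Real.pi ^ 2 * c ^ 2) * (1 + (x / c) ^ 2)⁻¹ =
      2 * (1 + c ^ 2) * (c ^ 2 + x ^ 2) / (Real.pi ^ 2 * (c ^ 2 + x ^ 2) ^ 2) := by
    field_simp
  rw [e1, e2]
  refine div_le_div_of_nonneg_right ?_ (by positivity)
  nlinarith [sq_nonneg (1 - |x|), sq_abs x, sq_nonneg (c * (1 - |x|)), sq_nonneg (c ^ 2)]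

/-- Cauchy–Schwarz; translation invariance of the `L²` norm makes `A` independent of `k`. -/
theorem exists_integral_cauchyKernel_le :
    ∃ A, 0 < A ∧ ∀ (θ : TargetSpace) k,
      Integrable (fun u => cauchyKernel c (k - u) * (1 + |k - u|) * |θ u|) ∧
      ∫ u, cauchyKernel c (k - u) * (1 + |k - u|) * |θ u| ≤ A * ‖θ‖ := by
  have hH := memLp_cauchyKernel_mul_one_add_abs hc
  refine ⟨‖hH.toLp _‖ + 1, by positivity, fun θ k => ?_⟩
  have mp : MeasurePreserving (fun u : ℝ => k - u) volume volume :=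
    Measure.measurePreserving_sub_left volume k
  have hk := hH.comp_measurePreserving mp
  have hn : ‖hk.toLp _‖ = ‖hH.toLp _‖ := by
    rw [Lp.norm_toLp, Lp.norm_toLp,
      eLpNorm_comp_measurePreserving hH.aestronglyMeasurable mp]
  have hab : (fun u => (|θ| : TargetSpace) u) =ᵐ[volume] fun u => |θ u| := Lp.coeFn_abs θ
  have hae : (fun u => inner ℝ (hk.toLp _ u) ((|θ| : TargetSpace) u)) =ᵐ[volume]
      fun u => cauchyKernel c (k - u) * (1 + |k - u|) * |θ u| := by
    filter_upwards [hk.coeFn_toLp, hab] with u h1 h2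
    rw [h1, h2]
    simp [mul_comm]
  refine ⟨(L2.integrable_inner (𝕜 := ℝ) (hk.toLp _) (|θ| : TargetSpace)).congr hae, ?_⟩
  rw [← integral_congr_ae hae, ← L2.inner_def]
  refine (real_inner_le_norm _ _).trans ?_
  rw [hn, norm_abs_eq_norm]
  nlinarith [norm_nonneg θ]

theorem exists_dressingWeight :
    ∃ A, 0 < A ∧ DressingWeight c A (fun _ => 1) ∧
      (∀ l, DressingWeight c A fun u => 1 + |u - l|) ∧
      ∀ l, DressingWeight c A fun u => cauchyKernel c (u - l) := by
  obtain ⟨A, hA, h⟩ := exists_integral_cauchyKernel_le hc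
  have hφ := continuous_cauchyKernel hc
  have hpos := cauchyKernel_pos hc
  -- A pointwise bound by two translates of `φ(x) (1 + |x|)`, centred at `k` and at `l`, suffices.
  -- Only the weight `φ(· - l)` needs the second one; its coefficients `2 + 2` account for the
  -- factor `4`.
  have key : ∀ w : ℝ → ℝ, Continuous w → (∀ u, 0 < w u) → ∀ C l : ℝ, ∀ B : ℝ,
      (∀ k u, cauchyKernel c (k - u) * w u ≤ w k * (C * (cauchyKernel c (k - u) * (1 + |k - u|)) +
        B * (cauchyKernel c (l - u) * (1 + |l - u|)))) → C + B ≤ 4 → 0 ≤ C → 0 ≤ B →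
      DressingWeight c (4 * A) w := by
    intro w hw hw0 C l B hle hCB hC hB
    have hdom : ∀ (θ : TargetSpace) (k : ℝ), Integrable fun u =>
        w k * (C * (cauchyKernel c (k - u) * (1 + |k - u|) * |θ u|) +
          B * (cauchyKernel c (l - u) * (1 + |l - u|) * |θ u|)) := fun θ k =>
      (((h θ k).1.const_mul C).add ((h θ l).1.const_mul B)).const_mul _
    have hpt : ∀ (θ : TargetSpace) (k u : ℝ), cauchyKernel c (k - u) * w u * |θ u| ≤
        w k * (C * (cauchyKernel c (k - u) * (1 + |k - u|) * |θ u|) +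
          B * (cauchyKernel c (l - u) * (1 + |l - u|) * |θ u|)) := fun θ k u => by
      refine (mul_le_mul_of_nonneg_right (hle k u) (abs_nonneg _)).trans_eq (by ring)
    have hint : ∀ (θ : TargetSpace) (k : ℝ),
        Integrable fun u => cauchyKernel c (k - u) * w u * |θ u| := fun θ k => by
      refine (hdom θ k).mono' ?_ (.of_forall fun u => ?_)
      · exact ((hφ.comp (by fun_prop)).mul hw).aestronglyMeasurable.mul
          (Lp.aestronglyMeasurable θ).norm
      · rw [Real.norm_of_nonneg]
        · exact hpt θ k u
        · exact mul_nonneg (mul_nonneg (hpos _).le (hw0 u).le) (abs_nonneg _)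
    refine ⟨hw, hw0, hint, fun θ k => ?_⟩
    refine (integral_mono (hint θ k) (hdom θ k) (hpt θ k)).trans ?_
    rw [integral_const_mul, integral_add ((h θ k).1.const_mul C) ((h θ l).1.const_mul B),
      integral_const_mul, integral_const_mul, mul_comm]
    refine mul_le_mul_of_nonneg_right ?_ (hw0 k).le
    have h1 := mul_le_mul_of_nonneg_left (h θ k).2 hC
    have h2 := mul_le_mul_of_nonneg_left (h θ l).2 hB
    have h3 := mul_le_mul_of_nonneg_right hCB (mul_nonneg hA.le (norm_nonneg θ))
    linarith
  have hself : ∀ x, cauchyKernel c x ≤ cauchyKernel c x * (1 + |x|) := fun x => by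
    nlinarith [hpos x, abs_nonneg x, mul_nonneg (hpos x).le (abs_nonneg x)]
  refine ⟨4 * A, by positivity, ?_, fun l => ?_, fun l => ?_⟩
  · refine key _ continuous_const (fun _ => one_pos) 1 0 0 (fun k u => ?_)
      (by norm_num) (by norm_num) (by norm_num)
    simpa using hself (k - u)
  · refine key _ (by fun_prop) (fun u => by positivity) 1 0 0 (fun k u => ?_)
      (by norm_num) (by norm_num) (by norm_num)
    have h1 : 1 + |u - l| ≤ (1 + |k - l|) * (1 + |k - u|) := by
      have : |u - l| ≤ |k - l| + |k - u| := by
        rw [abs_sub_comm k u, add_comm]; exact abs_sub_le u k l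
      nlinarith [mul_nonneg (abs_nonneg (k - l)) (abs_nonneg (k - u))]
    have := mul_le_mul_of_nonneg_left h1 (hpos (k - u)).le
    linarith
  · refine key _ (hφ.comp (by fun_prop)) (fun u => hpos _) 2 l 2 (fun k u => ?_)
      (by norm_num) (by norm_num) (by norm_num)
    have h1 := cauchyKernel_mul_le hc (k - u) (u - l)
    rw [sub_add_sub_cancel] at h1
    have h2 := hself (k - u)
    have h3 := hself (l - u)
    rw [cauchyKernel_sub_comm c u l] at h1 ⊢
    refine h1.trans ?_
    have := mul_le_mul_of_nonneg_left (add_le_add h2 h3) (hpos (k - l)).le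
    linarith

end

/-! ### Inverting `1 + 𝒦θ` in weighted spaces -/

open scoped BoundedContinuousFunction

/-- The operator `-𝒦θ`, acting by `Q ↦ ∫ φ(k - u) θ(u) Q(u) du` with the Cauchy density `φ`. -/
noncomputable def cauchyConv (c : ℝ) (θ : TargetSpace) (Q : ℝ → ℝ) (k : ℝ) : ℝ :=
  ∫ u, cauchyKernel c (k - u) * θ u * Q u

theorem isDressed_iff {c : ℝ} {θ : TargetSpace} {f Q : ℝ → ℝ} :
    IsDressed c θ f Q ↔ LinearGrowth Q ∧ ∀ k, Q k = f k + cauchyConv c θ Q k := by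
  unfold IsDressed cauchyConv
  simp only [liebLinigerKernel_eq, neg_mul, integral_neg, ← sub_eq_add_neg, sub_eq_iff_eq_add]

namespace DressingWeight

variable {c A : ℝ} {w : ℝ → ℝ} (hc : 0 < c) (hw : DressingWeight c A w)
include hc hw

theorem constant_nonneg_mul (θ : TargetSpace) : 0 ≤ A * ‖θ‖ := by
  have h := hw.bound θ 0
  have h0 : 0 ≤ ∫ u, cauchyKernel c (0 - u) * w u * |θ u| := integral_nonneg fun u =>
    mul_nonneg (mul_nonneg (cauchyKernel_pos hc _).le (hw.pos u).le) (abs_nonneg _)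
  exact nonneg_of_mul_nonneg_left (h0.trans h) (hw.pos 0)

section

variable {θ : TargetSpace} {Q : ℝ → ℝ} {C : ℝ} (hQ : Continuous Q) (hQC : ∀ u, |Q u| ≤ C * w u)
include hQ hQC

omit hw hQ in
theorem abs_integrand_le (k u : ℝ) :
    |cauchyKernel c (k - u) * θ u * Q u| ≤ C * (cauchyKernel c (k - u) * w u * |θ u|) := by
  rw [abs_mul, abs_mul, abs_of_pos (cauchyKernel_pos hc _)]
  have := mul_le_mul_of_nonneg_left (hQC u)
    (mul_nonneg (cauchyKernel_pos hc (k - u)).le (abs_nonneg (θ u)))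
  linarith

theorem integrable_cauchyConv (k : ℝ) :
    Integrable fun u => cauchyKernel c (k - u) * θ u * Q u := by
  refine ((hw.integrable θ k).const_mul C).mono' ?_
    (.of_forall fun u => abs_integrand_le hc hQC k u)
  exact (((continuous_cauchyKernel hc).comp (by fun_prop)).aestronglyMeasurable.mul
    (Lp.aestronglyMeasurable θ)).mul hQ.aestronglyMeasurable

theorem integral_abs_le (k : ℝ) :
    ∫ u, |cauchyKernel c (k - u) * θ u * Q u| ≤ C * (A * ‖θ‖ * w k) := by
  have hC : 0 ≤ C := nonneg_of_mul_nonneg_left ((abs_nonneg _).trans (hQC 0)) (hw.pos 0)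
  refine (integral_mono (hw.integrable_cauchyConv hc hQ hQC k).abs
    ((hw.integrable θ k).const_mul C) fun u => abs_integrand_le hc hQC k u).trans ?_
  rw [integral_const_mul]
  exact mul_le_mul_of_nonneg_left (hw.bound θ k) hC

theorem abs_cauchyConv_le (k : ℝ) : |cauchyConv c θ Q k| ≤ C * (A * ‖θ‖ * w k) :=
  (abs_integral_le_integral_abs).trans (hw.integral_abs_le hc hQ hQC k)

/-- Beyond continuity, the explicit factor `|k - l|` is what later separates velocities at nearby
points. -/
theorem abs_cauchyConv_sub_le (k l : ℝ) :
    |cauchyConv c θ Q k - cauchyConv c θ Q l| ≤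
      1 / (2 * c) * |k - l| * (C * (A * ‖θ‖) * (w k + w l)) := by
  have hk := hw.integrable_cauchyConv hc (θ := θ) hQ hQC k
  have hl := hw.integrable_cauchyConv hc (θ := θ) hQ hQC l
  unfold cauchyConv
  rw [← integral_sub hk hl]
  refine (abs_integral_le_integral_abs).trans ?_
  refine (integral_mono (hk.sub hl).abs
    ((hk.abs.add hl.abs).const_mul (1 / (2 * c) * |k - l|)) fun u => ?_).trans ?_
  · have h := abs_cauchyKernel_sub_le hc (k - u) (l - u)
    rw [sub_sub_sub_cancel_right] at h
    have h' := mul_le_mul_of_nonneg_right (mul_le_mul_of_nonneg_right h (abs_nonneg (θ u)))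
      (abs_nonneg (Q u))
    rw [← abs_mul, ← abs_mul, sub_mul, sub_mul] at h'
    refine h'.trans_eq ?_
    simp only [Pi.add_apply, abs_mul, abs_of_pos (cauchyKernel_pos hc _)]
    ring
  · rw [integral_const_mul]
    simp only [Pi.add_apply]
    rw [integral_add hk.abs hl.abs]
    have h1 := hw.integral_abs_le hc (θ := θ) hQ hQC k
    have h2 := hw.integral_abs_le hc (θ := θ) hQ hQC l
    refine mul_le_mul_of_nonneg_left ?_ (by positivity)
    linarith

theorem continuous_cauchyConv : Continuous (cauchyConv c θ Q) := by
  refine continuous_iff_continuousAt.2 fun l => ?_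
  rw [ContinuousAt, tendsto_iff_dist_tendsto_zero]
  refine squeeze_zero (fun _ => dist_nonneg)
    (fun k => hw.abs_cauchyConv_sub_le hc hQ hQC k l) ?_
  have hcont : Continuous fun k => 1 / (2 * c) * |k - l| * (C * (A * ‖θ‖) * (w k + w l)) := by
    have := hw.continuous
    fun_prop
  simpa using hcont.tendsto l

end

omit hc in
theorem abs_mul_le (g : ℝ →ᵇ ℝ) (u : ℝ) : |w u * g u| ≤ ‖g‖ * w u := by
  rw [abs_mul, abs_of_pos (hw.pos u), mul_comm]
  exact mul_le_mul_of_nonneg_right (g.norm_coe_le_norm u) (hw.pos u).le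

omit hc in
theorem continuous_mul (g : ℝ →ᵇ ℝ) : Continuous fun u => w u * g u :=
  hw.continuous.mul g.continuous

omit hc in
theorem abs_div_le {f : ℝ → ℝ} {C k : ℝ} (h : |f k| ≤ C * w k) : |f k / w k| ≤ C := by
  rwa [abs_div, abs_of_pos (hw.pos k), div_le_iff₀ (hw.pos k)]

omit hc in
/-- A continuous function of size `O(w)`, divided by the weight `w`. -/
noncomputable def normalize {f : ℝ → ℝ} (hf : Continuous f) (C : ℝ)
    (hC : ∀ u, |f u| ≤ C * w u) : ℝ →ᵇ ℝ :=
  .ofNormedAddCommGroup (fun k => f k / w k)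
    (hf.div hw.continuous fun u => (hw.pos u).ne') C fun _ => hw.abs_div_le (hC _)

omit hc in
theorem norm_normalize_le {f : ℝ → ℝ} (hf : Continuous f) {C : ℝ} (hC0 : 0 ≤ C)
    (hC : ∀ u, |f u| ≤ C * w u) : ‖hw.normalize hf C hC‖ ≤ C :=
  BoundedContinuousFunction.norm_ofNormedAddCommGroup_le _ hC0 fun _ => hw.abs_div_le (hC _)

/-- The value `w⁻¹ (-𝒦θ) (w g)` of the conjugated operator `-𝒦θ` at a bounded continuous `g`. -/
noncomputable def conjugate (θ : TargetSpace) (g : ℝ →ᵇ ℝ) : ℝ →ᵇ ℝ :=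
  hw.normalize (hw.continuous_cauchyConv hc (θ := θ) (hw.continuous_mul g) (hw.abs_mul_le g))
    (A * ‖θ‖ * ‖g‖) fun k =>
      (hw.abs_cauchyConv_le hc (hw.continuous_mul g) (hw.abs_mul_le g) k).trans_eq (by ring)

theorem conjugate_apply (θ : TargetSpace) (g : ℝ →ᵇ ℝ) (k : ℝ) :
    hw.conjugate hc θ g k = cauchyConv c θ (fun u => w u * g u) k / w k := rfl

theorem norm_conjugate_le (θ : TargetSpace) (g : ℝ →ᵇ ℝ) :
    ‖hw.conjugate hc θ g‖ ≤ A * ‖θ‖ * ‖g‖ :=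
  hw.norm_normalize_le _ (mul_nonneg (hw.constant_nonneg_mul hc θ) (norm_nonneg g)) _

/-- The operator `g ↦ w⁻¹ (-𝒦θ) (w g)` on bounded continuous functions. -/
noncomputable def operator :
    TargetSpace →L[ℝ] (ℝ →ᵇ ℝ) →L[ℝ] (ℝ →ᵇ ℝ) :=
  LinearMap.mkContinuous₂
    (LinearMap.mk₂ ℝ
      (hw.conjugate hc)
      (fun θ₁ θ₂ g => by
        ext k
        simp only [conjugate_apply, BoundedContinuousFunction.coe_add, Pi.add_apply]
        rw [← add_div, cauchyConv, cauchyConv, cauchyConv, ← integral_add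
          (hw.integrable_cauchyConv hc (hw.continuous_mul g) (hw.abs_mul_le g) k)
          (hw.integrable_cauchyConv hc (hw.continuous_mul g) (hw.abs_mul_le g) k)]
        congr 1
        refine integral_congr_ae ?_
        filter_upwards [Lp.coeFn_add θ₁ θ₂] with u hu
        rw [hu, Pi.add_apply]
        ring)
      (fun a θ g => by
        ext k
        simp only [conjugate_apply, BoundedContinuousFunction.coe_smul, smul_eq_mul]
        rw [← mul_div_assoc, cauchyConv, cauchyConv, ← integral_const_mul]
        congr 1
        refine integral_congr_ae ?_
        filter_upwards [Lp.coeFn_smul a θ] with u hu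
        rw [hu, Pi.smul_apply, smul_eq_mul]
        ring)
      (fun θ g₁ g₂ => by
        ext k
        simp only [conjugate_apply, BoundedContinuousFunction.coe_add, Pi.add_apply]
        rw [← add_div, cauchyConv, cauchyConv, cauchyConv, ← integral_add
          (hw.integrable_cauchyConv hc (hw.continuous_mul g₁) (hw.abs_mul_le g₁) k)
          (hw.integrable_cauchyConv hc (hw.continuous_mul g₂) (hw.abs_mul_le g₂) k)]
        simp only [mul_add])
      (fun a θ g => by
        ext k
        simp only [conjugate_apply, BoundedContinuousFunction.coe_smul, smul_eq_mul]
        rw [← mul_div_assoc, cauchyConv, cauchyConv, ← integral_const_mul]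
        congr 1
        refine integral_congr_ae (.of_forall fun u => ?_)
        ring))
    A (hw.norm_conjugate_le hc)

theorem operator_apply (θ : TargetSpace) (g : ℝ →ᵇ ℝ) :
    hw.operator hc θ g = hw.conjugate hc θ g := rfl

theorem isUnit_one_sub {θ : TargetSpace} (hθ : A * ‖θ‖ ≤ 1 / 2) :
    IsUnit (1 - hw.operator hc θ) := by
  have h : ‖hw.operator hc θ‖ ≤ 1 / 2 := (ContinuousLinearMap.opNorm_le_bound _ (hw.constant_nonneg_mul hc θ)
    (hw.norm_conjugate_le hc θ)).trans hθ
  exact isUnit_one_sub_of_norm_lt_one (x := hw.operator hc θ) (h.trans_lt one_half_lt_one)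

theorem inverse_solves {θ : TargetSpace} (hθ : A * ‖θ‖ ≤ 1 / 2) (g : ℝ →ᵇ ℝ) :
    Ring.inverse (1 - hw.operator hc θ) g =
      g + hw.operator hc θ (Ring.inverse (1 - hw.operator hc θ) g) := by
  have h := Ring.mul_inverse_cancel _ (hw.isUnit_one_sub hc hθ)
  have h' := DFunLike.congr_fun h g
  simp only [mul_apply_eq_comp, sub_apply, one_apply_eq_self] at h'
  exact sub_eq_iff_eq_add.1 h'

/-- The a priori constant `C'` drops out: in the weighted norm the convolution is a contraction by
`1 / 2`, which is absorbed on the left. With `C = 0` this is uniqueness. -/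
theorem abs_le_of_solves {θ : TargetSpace} (hθ : A * ‖θ‖ ≤ 1 / 2) {f Q : ℝ → ℝ} {C C' : ℝ}
    (hQ : Continuous Q) (hQC : ∀ u, |Q u| ≤ C' * w u) (hfC : ∀ u, |f u| ≤ C * w u)
    (h : ∀ k, Q k = f k + cauchyConv c θ Q k) (k : ℝ) : |Q k| ≤ 2 * C * w k := by
  set g := hw.normalize hQ C' hQC with hg
  have hgu : ∀ u, g u = Q u / w u := fun u => rfl
  have hQg : ∀ u, |Q u| ≤ ‖g‖ * w u := fun u => by
    have := g.norm_coe_le_norm u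
    rwa [hgu, Real.norm_eq_abs, abs_div, abs_of_pos (hw.pos u), div_le_iff₀ (hw.pos u)] at this
  have hC : 0 ≤ C := nonneg_of_mul_nonneg_left ((abs_nonneg _).trans (hfC 0)) (hw.pos 0)
  have key : ‖g‖ ≤ C + 1 / 2 * ‖g‖ := by
    refine (BoundedContinuousFunction.norm_le (by positivity)).2 fun u => ?_
    rw [hgu, Real.norm_eq_abs]
    refine hw.abs_div_le ?_
    rw [h u]
    refine (abs_add_le _ _).trans ?_
    have h1 := hw.abs_cauchyConv_le hc (θ := θ) hQ hQg u
    have h2 := mul_le_mul_of_nonneg_right hθ (mul_nonneg (norm_nonneg g) (hw.pos u).le)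
    have h3 := hfC u
    linarith
  exact (hQg k).trans (mul_le_mul_of_nonneg_right (by linarith) (hw.pos k).le)

/-- The final clause keeps the solution as an operator inverse, the form that can be differentiated
in `θ`. -/
theorem exists_solution {θ : TargetSpace} (hθ : A * ‖θ‖ ≤ 1 / 2) {f : ℝ → ℝ} {C : ℝ}
    (hf : Continuous f) (hfC : ∀ u, |f u| ≤ C * w u) :
    ∃ Q, Continuous Q ∧ (∀ u, |Q u| ≤ 2 * C * w u) ∧ (∀ k, Q k = f k + cauchyConv c θ Q k) ∧
      Q = fun k => w k *
        Ring.inverse (1 - hw.operator hc θ) (hw.normalize hf C hfC) k := by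
  set g := Ring.inverse (1 - hw.operator hc θ) (hw.normalize hf C hfC) with hg
  have hs : ∀ k, w k * g k = f k + cauchyConv c θ (fun u => w u * g u) k := fun k => by
    have h := DFunLike.congr_fun (hw.inverse_solves hc hθ (hw.normalize hf C hfC)) k
    have hk := (hw.pos k).ne'
    rw [BoundedContinuousFunction.add_apply, ← hg, operator_apply, conjugate_apply] at h
    rw [h, normalize, BoundedContinuousFunction.coe_ofNormedAddCommGroup]
    field_simp
  exact ⟨fun k => w k * g k, hw.continuous_mul g,
    hw.abs_le_of_solves hc hθ (hw.continuous_mul g) (hw.abs_mul_le g) hfC hs, hs, rfl⟩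

end DressingWeight

theorem exists_hasFDerivAt_inverse_one_sub {E X : Type*} [NormedAddCommGroup E] [NormedSpace ℝ E]
    [NormedAddCommGroup X] [NormedSpace ℝ X] [CompleteSpace X] (T : E →L[ℝ] X →L[ℝ] X) {θ : E}
    (h : IsUnit (1 - T θ)) (g : X) (ev : X →L[ℝ] ℝ) :
    ∃ D : E →L[ℝ] ℝ, HasFDerivAt (fun ϑ => ev (Ring.inverse (1 - T ϑ) g)) D θ ∧
      ∀ η, D η = ev (Ring.inverse (1 - T θ) (T η (Ring.inverse (1 - T θ) g))) := by
  obtain ⟨x, hx⟩ := h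
  have hxi : Ring.inverse (1 - T θ) = ↑x⁻¹ := by rw [← hx, Ring.inverse_unit]
  have d1 : HasFDerivAt (fun ϑ => 1 - T ϑ) (-T) θ := T.hasFDerivAt.const_sub 1
  have d2 := hasFDerivAt_ringInverse (𝕜 := ℝ) x
  rw [hx] at d2
  have d3 := HasFDerivAt.comp (g := Ring.inverse) θ d2 d1
  have d4 := (ev ∘L ContinuousLinearMap.apply ℝ X g).hasFDerivAt.comp θ d3
  refine ⟨_, d4, fun η => ?_⟩
  simp [hxi]

/-! ### The dressing operator on functions of linear growth -/

theorem linearGrowth_iff {f : ℝ → ℝ} :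
    LinearGrowth f ↔ Continuous f ∧ ∃ C, ∀ u, |f u| ≤ C * (1 + |u - 0|) := by
  simp [LinearGrowth]

theorem LinearGrowth.of_le {f w : ℝ → ℝ} {B C : ℝ} (hf : Continuous f) (hC : 0 ≤ C)
    (h : ∀ u, |f u| ≤ C * w u) (hw : ∀ u, w u ≤ B * (1 + |u|)) : LinearGrowth f :=
  ⟨hf, C * B, fun u => (h u).trans
    ((mul_le_mul_of_nonneg_left (hw u) hC).trans_eq (mul_assoc _ _ _).symm)⟩

theorem LinearGrowth.sub {f g : ℝ → ℝ} (hf : LinearGrowth f) (hg : LinearGrowth g) :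
    LinearGrowth fun k => f k - g k := by
  obtain ⟨hf, C, hC⟩ := hf
  obtain ⟨hg, D, hD⟩ := hg
  refine ⟨hf.sub hg, C + D, fun k => (abs_sub _ _).trans ?_⟩
  linarith [hC k, hD k]

theorem LinearGrowth.const_mul {f : ℝ → ℝ} (hf : LinearGrowth f) (a : ℝ) :
    LinearGrowth fun k => a * f k := by
  obtain ⟨hf, C, hC⟩ := hf
  refine ⟨hf.const_mul a, |a| * C, fun k => ?_⟩
  rw [abs_mul, mul_assoc]
  exact mul_le_mul_of_nonneg_left (hC k) (abs_nonneg a)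

theorem linearGrowth_const (a : ℝ) : LinearGrowth fun _ => a :=
  .of_le (w := fun _ => 1) (B := 1) (C := |a|) continuous_const (abs_nonneg a) (by simp)
    fun u => by simp

theorem linearGrowth_id : LinearGrowth fun k => k :=
  ⟨continuous_id, 1, fun k => by linarith⟩

theorem cauchyKernel_le {c : ℝ} (hc : 0 < c) (x : ℝ) : cauchyKernel c x ≤ cauchyKernel c 0 := by
  have := Real.pi_pos
  unfold cauchyKernel
  have := sq_nonneg x
  gcongr 1 / Real.pi * (c / (c ^ 2 + ?_))
  simpa using this

theorem linearGrowth_cauchyKernel {c : ℝ} (hc : 0 < c) (k : ℝ) :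
    LinearGrowth fun u => cauchyKernel c (u - k) := by
  refine .of_le (w := fun u => cauchyKernel c (u - k)) (C := 1) (B := cauchyKernel c 0)
    ((continuous_cauchyKernel hc).comp (by fun_prop)) zero_le_one (fun u => ?_) fun u => ?_
  · rw [abs_of_pos (cauchyKernel_pos hc _), one_mul]
  · nlinarith [cauchyKernel_le hc (u - k), abs_nonneg u, cauchyKernel_pos hc 0]

theorem cauchyConv_sub {c : ℝ} {θ : TargetSpace} {Q₁ Q₂ : ℝ → ℝ} {k : ℝ}
    (h₁ : Integrable fun u => cauchyKernel c (k - u) * θ u * Q₁ u)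
    (h₂ : Integrable fun u => cauchyKernel c (k - u) * θ u * Q₂ u) :
    cauchyConv c θ (fun u => Q₁ u - Q₂ u) k = cauchyConv c θ Q₁ k - cauchyConv c θ Q₂ k := by
  unfold cauchyConv
  rw [← integral_sub h₁ h₂]
  simp only [mul_sub]

section

variable {c A : ℝ} (hc : 0 < c) (hlin : ∀ l, DressingWeight c A fun u => 1 + |u - l|)
include hc hlin

theorem integrable_cauchyConv (θ : TargetSpace) {Q : ℝ → ℝ} (hQ : LinearGrowth Q) (k : ℝ) :
    Integrable fun u => cauchyKernel c (k - u) * θ u * Q u := by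
  obtain ⟨hQc, C, hC⟩ := linearGrowth_iff.1 hQ
  exact (hlin 0).integrable_cauchyConv hc hQc hC k

theorem linearGrowth_cauchyConv (θ : TargetSpace) {Q : ℝ → ℝ} (hQ : LinearGrowth Q) :
    LinearGrowth (cauchyConv c θ Q) := by
  obtain ⟨hQc, C, hC⟩ := linearGrowth_iff.1 hQ
  refine linearGrowth_iff.2 ⟨(hlin 0).continuous_cauchyConv hc hQc hC, C * (A * ‖θ‖), fun k => ?_⟩
  exact ((hlin 0).abs_cauchyConv_le hc hQc hC k).trans_eq (by ring)

theorem IsDressed.sub {θ : TargetSpace} {f₁ f₂ Q₁ Q₂ : ℝ → ℝ} (h₁ : IsDressed c θ f₁ Q₁)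
    (h₂ : IsDressed c θ f₂ Q₂) :
    IsDressed c θ (fun k => f₁ k - f₂ k) fun k => Q₁ k - Q₂ k := by
  rw [isDressed_iff] at *
  refine ⟨h₁.1.sub h₂.1, fun k => ?_⟩
  rw [cauchyConv_sub (integrable_cauchyConv hc hlin θ h₁.1 k)
    (integrable_cauchyConv hc hlin θ h₂.1 k)]
  linarith [h₁.2 k, h₂.2 k]

omit hc hlin in
theorem IsDressed.const_mul {θ : TargetSpace} {f Q : ℝ → ℝ} (h : IsDressed c θ f Q) (a : ℝ) :
    IsDressed c θ (fun k => a * f k) fun k => a * Q k := by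
  rw [isDressed_iff] at *
  refine ⟨h.1.const_mul a, fun k => ?_⟩
  have : cauchyConv c θ (fun u => a * Q u) k = a * cauchyConv c θ Q k := by
    unfold cauchyConv
    rw [← integral_const_mul]
    simp only [mul_left_comm]
  rw [this, h.2 k]
  ring

section

variable {θ : TargetSpace} (hθ : A * ‖θ‖ ≤ 1 / 2)
include hθ

theorem IsDressed.unique {f Q₁ Q₂ : ℝ → ℝ} (h₁ : IsDressed c θ f Q₁) (h₂ : IsDressed c θ f Q₂) :
    Q₁ = Q₂ := by
  have h := IsDressed.sub hc hlin h₁ h₂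
  rw [isDressed_iff] at h
  obtain ⟨hQc, C, hC⟩ := linearGrowth_iff.1 h.1
  funext k
  have := (hlin 0).abs_le_of_solves hc hθ (C := 0) hQc hC (by simp) h.2 k
  simpa [sub_eq_zero] using this

theorem dressingExists : DressingExists c θ := fun f hf => by
  obtain ⟨hfc, C, hC⟩ := linearGrowth_iff.1 hf
  obtain ⟨Q, hQ, hQC, h, -⟩ := (hlin 0).exists_solution hc hθ hfc hC
  have : IsDressed c θ f Q := isDressed_iff.2 ⟨linearGrowth_iff.2 ⟨hQ, _, hQC⟩, h⟩
  exact ⟨Q, this, fun Q' h' => IsDressed.unique hc hlin hθ h' this⟩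

theorem isDressed_dress {f : ℝ → ℝ} (hf : LinearGrowth f) : IsDressed c θ f (dress c θ f) := by
  have h := (dressingExists hc hlin hθ f hf).exists
  rw [dress, dif_pos h]
  exact h.choose_spec

theorem IsDressed.dress_eq {f Q : ℝ → ℝ} (h : IsDressed c θ f Q) (hf : LinearGrowth f) :
    dress c θ f = Q :=
  IsDressed.unique hc hlin hθ (isDressed_dress hc hlin hθ hf) h

theorem dress_apply {f : ℝ → ℝ} {C : ℝ} (hf : Continuous f)
    (hC : ∀ u, |f u| ≤ C * (1 + |u - 0|)) (k : ℝ) :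
    dress c θ f k = (1 + |k - 0|) *
      Ring.inverse (1 - (hlin 0).operator hc θ) ((hlin 0).normalize hf C hC) k := by
  obtain ⟨Q, hQ, hQC, h, he⟩ := (hlin 0).exists_solution hc hθ hf hC
  have hQ' : IsDressed c θ f Q := isDressed_iff.2 ⟨linearGrowth_iff.2 ⟨hQ, _, hQC⟩, h⟩
  rw [hQ'.dress_eq hc hlin hθ (linearGrowth_iff.2 ⟨hf, C, hC⟩), he]

/-- A priori bound for dressed functions in terms of an admissible weight. -/
theorem abs_dress_le {w : ℝ → ℝ} (hw : DressingWeight c A w) {B C : ℝ}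
    (hwB : ∀ u, w u ≤ B * (1 + |u|)) {f : ℝ → ℝ} (hf : Continuous f)
    (hC : ∀ u, |f u| ≤ C * w u) (k : ℝ) : |dress c θ f k| ≤ 2 * C * w k := by
  have hC0 : 0 ≤ C := nonneg_of_mul_nonneg_left ((abs_nonneg _).trans (hC 0)) (hw.pos 0)
  obtain ⟨Q, hQ, hQC, h, -⟩ := hw.exists_solution hc hθ hf hC
  -- The solution built in the `w`-space also has linear growth, so uniqueness in that class
  -- identifies it with `dress`.
  have hQ' : IsDressed c θ f Q :=
    isDressed_iff.2 ⟨.of_le hQ (by positivity) hQC hwB, h⟩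
  rw [hQ'.dress_eq hc hlin hθ (.of_le hf hC0 hC hwB)]
  exact hQC k

theorem linearGrowth_dress {f : ℝ → ℝ} (hf : LinearGrowth f) : LinearGrowth (dress c θ f) :=
  (isDressed_dress hc hlin hθ hf).1

theorem dress_eq_add {f : ℝ → ℝ} (hf : LinearGrowth f) (k : ℝ) :
    dress c θ f k = f k + cauchyConv c θ (dress c θ f) k :=
  (isDressed_iff.1 (isDressed_dress hc hlin hθ hf)).2 k

end

/-! ### Duality and the dressed kernel -/

section

variable {F : ℝ → ℝ} {M k : ℝ} (hF : Continuous F) (hFM : ∀ u, |F u| ≤ M * cauchyKernel c (u - k))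
include hF hFM

theorem integrable_pairing (θ : TargetSpace) {Q : ℝ → ℝ} (hQ : LinearGrowth Q) :
    Integrable fun u => θ u * F u * Q u := by
  refine ((integrable_cauchyConv hc hlin θ hQ k).abs.const_mul M).mono' ?_
    (.of_forall fun u => ?_)
  · exact ((Lp.aestronglyMeasurable θ).mul hF.aestronglyMeasurable).mul
      hQ.1.aestronglyMeasurable
  · have := mul_le_mul_of_nonneg_right (hFM u) (mul_nonneg (abs_nonneg (θ u)) (abs_nonneg (Q u)))
    rw [Real.norm_eq_abs, abs_mul, abs_mul, abs_mul, abs_mul, abs_of_pos (cauchyKernel_pos hc _),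
      cauchyKernel_sub_comm c k u]
    linarith

/-- Fubini and evenness of `φ`. The decay of `F` compensates the linear growth of `G` and gives
joint integrability. -/
theorem integral_mul_cauchyConv_comm (hφ : ∀ l, DressingWeight c A fun u => cauchyKernel c (u - l))
    (θ η : TargetSpace) {G : ℝ → ℝ} (hG : LinearGrowth G) :
    ∫ u, θ u * F u * cauchyConv c η G u = ∫ u, η u * G u * cauchyConv c θ F u := by
  have hmeas : AEStronglyMeasurable (fun p : ℝ × ℝ =>
      θ p.1 * F p.1 * (cauchyKernel c (p.1 - p.2) * η p.2 * G p.2)) (volume.prod volume) := by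
    have h1 := (Lp.aestronglyMeasurable θ).comp_fst (ν := (volume : Measure ℝ))
    have h2 := (Lp.aestronglyMeasurable η).comp_snd (μ := (volume : Measure ℝ))
    have hφc := continuous_cauchyKernel hc
    have hGc := hG.1
    exact (h1.mul (by fun_prop : Continuous fun p : ℝ × ℝ => F p.1).aestronglyMeasurable).mul
      (((by fun_prop : Continuous fun p : ℝ × ℝ =>
        cauchyKernel c (p.1 - p.2)).aestronglyMeasurable.mul h2).mul
        (by fun_prop : Continuous fun p : ℝ × ℝ => G p.2).aestronglyMeasurable)
  have hsec : ∀ u y, θ u * F u * (cauchyKernel c (u - y) * η y * G y) =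
      η y * G y * (cauchyKernel c (y - u) * θ u * F u) := fun u y => by
    rw [cauchyKernel_sub_comm c u y]; ring
  have hinner : ∀ y, Integrable fun u => cauchyKernel c (y - u) * θ u * F u := fun y =>
    (hφ k).integrable_cauchyConv hc hF hFM y
  have hint : Integrable (fun p : ℝ × ℝ =>
      θ p.1 * F p.1 * (cauchyKernel c (p.1 - p.2) * η p.2 * G p.2)) (volume.prod volume) := by
    rw [integrable_prod_iff' hmeas]
    refine ⟨.of_forall fun y => ?_, ?_⟩
    · simp only [hsec]
      exact (hinner y).const_mul _
    · refine ((integrable_cauchyConv hc hlin η hG k).abs.const_mul (M * (A * ‖θ‖))).mono'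
        hmeas.norm.prod_swap.integral_prod_right' (.of_forall fun y => ?_)
      simp only [hsec, norm_mul (η y * G y), integral_const_mul]
      rw [norm_mul, norm_norm, Real.norm_of_nonneg (integral_nonneg fun u => norm_nonneg _)]
      simp only [Real.norm_eq_abs]
      have h := mul_le_mul_of_nonneg_left
        ((hφ k).integral_abs_le hc (θ := θ) hF hFM y) (abs_nonneg (η y * G y))
      refine h.trans_eq ?_
      rw [abs_mul (_ * _), abs_mul, abs_mul, abs_of_pos (cauchyKernel_pos hc _),
        cauchyKernel_sub_comm c k y]
      ring
  unfold cauchyConv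
  simp only [← integral_const_mul]
  rw [integral_integral_swap hint]
  simp only [hsec]

end

end

/-- The kernel `(k, u) ↦ R(k, u)` with `U = 1 + Rθ`: the dressing of `u ↦ -𝒦(u, k)`. -/
noncomputable def dressedKernel (c : ℝ) (θ : TargetSpace) (k : ℝ) : ℝ → ℝ :=
  dress c θ fun u => cauchyKernel c (u - k)

section

variable {c A : ℝ} (hc : 0 < c) (hlin : ∀ l, DressingWeight c A fun u => 1 + |u - l|)
  (hφ : ∀ l, DressingWeight c A fun u => cauchyKernel c (u - l)) {θ : TargetSpace}
include hc hlin hφ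

theorem abs_dressedKernel_le (hθ : A * ‖θ‖ ≤ 1 / 2) (k u : ℝ) :
    |dressedKernel c θ k u| ≤ 2 * cauchyKernel c (u - k) := by
  have h := abs_dress_le hc hlin hθ (hφ k) (B := cauchyKernel c 0) (C := 1)
    (f := fun u => cauchyKernel c (u - k)) (fun u => ?_) (hφ k).continuous (fun u => ?_) u
  · simpa [dressedKernel] using h
  · nlinarith [cauchyKernel_le hc (u - k), abs_nonneg u, cauchyKernel_pos hc 0]
  · rw [abs_of_pos (cauchyKernel_pos hc _), one_mul]

omit hφ in
theorem linearGrowth_dressedKernel (hθ : A * ‖θ‖ ≤ 1 / 2) (k : ℝ) :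
    LinearGrowth (dressedKernel c θ k) :=
  linearGrowth_dress hc hlin hθ (linearGrowth_cauchyKernel hc k)

omit hφ in
theorem cauchyConv_dressedKernel (hθ : A * ‖θ‖ ≤ 1 / 2) (k u : ℝ) :
    cauchyConv c θ (dressedKernel c θ k) u = dressedKernel c θ k u - cauchyKernel c (u - k) := by
  have := dress_eq_add hc hlin hθ (linearGrowth_cauchyKernel hc k) u
  rw [dressedKernel]
  linarith

/-- Duality moves the convolution onto `R_k`, where the equation of `R_k` replaces it by `R_k - φ(·
- k)`. -/
theorem integral_mul_dressedKernel_sub (hθ : A * ‖θ‖ ≤ 1 / 2) (η : TargetSpace) {G : ℝ → ℝ}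
    (hG : LinearGrowth G) (k : ℝ) :
    ∫ u, θ u * dressedKernel c θ k u * cauchyConv c η G u =
      (∫ u, η u * dressedKernel c θ k u * G u) - cauchyConv c η G k := by
  have hr := linearGrowth_dressedKernel hc hlin hθ k
  have hrM := abs_dressedKernel_le hc hlin hφ hθ k
  rw [integral_mul_cauchyConv_comm hc hlin hr.1 hrM hφ θ η hG, cauchyConv,
    ← integral_sub (integrable_pairing hc hlin hr.1 hrM η hG)
      (integrable_cauchyConv hc hlin η hG k)]
  refine integral_congr_ae (.of_forall fun u => ?_)
  simp only
  rw [cauchyConv_dressedKernel hc hlin hθ, cauchyKernel_sub_comm c k u]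
  ring

/-- `(1 + 𝒦θ)⁻¹(-𝒦η)` has the integral kernel `R(k, u) η(u)`. -/
theorem eq_integral_dressedKernel (hθ : A * ‖θ‖ ≤ 1 / 2) {η : TargetSpace} {f G : ℝ → ℝ}
    (hf : LinearGrowth f) (hG : LinearGrowth G)
    (h : ∀ k, G k = cauchyConv c η f k + cauchyConv c θ G k) (k : ℝ) :
    G k = ∫ u, η u * dressedKernel c θ k u * f u := by
  have hr := linearGrowth_dressedKernel hc hlin hθ k
  have hrM := abs_dressedKernel_le hc hlin hφ hθ k
  have h1 := integral_mul_dressedKernel_sub hc hlin hφ hθ η hf k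
  have h2 := integral_mul_dressedKernel_sub hc hlin hφ hθ θ hG k
  -- The equation for `G` is paired with `θ R_k`. Combined with `h1` and `h2`, the pairings with `θ`
  -- cancel and the equation at `k` leaves the claim.
  have h3 : ∫ u, θ u * dressedKernel c θ k u * G u =
      (∫ u, θ u * dressedKernel c θ k u * cauchyConv c η f u) +
        ∫ u, θ u * dressedKernel c θ k u * cauchyConv c θ G u := by
    rw [← integral_add
      (integrable_pairing hc hlin hr.1 hrM θ (linearGrowth_cauchyConv hc hlin η hf))
      (integrable_pairing hc hlin hr.1 hrM θ (linearGrowth_cauchyConv hc hlin θ hG))]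
    refine integral_congr_ae (.of_forall fun u => ?_)
    simp only
    rw [← mul_add, ← h u]
  linarith [h k]

/-- Duality for the pair `R_k`, `R_l`: both sides contain the same integral `∫ θ R_k R_l`, and what
remains is the symmetry. -/
theorem dressedKernel_symm (hθ : A * ‖θ‖ ≤ 1 / 2) (k l : ℝ) :
    dressedKernel c θ k l = dressedKernel c θ l k := by
  have hk := linearGrowth_dressedKernel hc hlin hθ k
  have hl := linearGrowth_dressedKernel hc hlin hθ l
  have h := integral_mul_cauchyConv_comm hc hlin hk.1
    (abs_dressedKernel_le hc hlin hφ hθ k) hφ θ θ hl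
  rw [integral_mul_dressedKernel_sub hc hlin hφ hθ θ hl,
    integral_mul_dressedKernel_sub hc hlin hφ hθ θ hk, cauchyConv_dressedKernel hc hlin hθ,
    cauchyConv_dressedKernel hc hlin hθ, cauchyKernel_sub_comm c k l] at h
  have h' : ∫ u, θ u * dressedKernel c θ k u * dressedKernel c θ l u =
      ∫ u, θ u * dressedKernel c θ l u * dressedKernel c θ k u :=
    integral_congr_ae (.of_forall fun u => mul_right_comm _ _ _)
  linarith

theorem memLp_dressedKernel_mul (hθ : A * ‖θ‖ ≤ 1 / 2) {f : ℝ → ℝ} (hf : LinearGrowth f) (k : ℝ) :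
    MemLp (fun u => dressedKernel c θ k u * f u) 2 := by
  have mp : MeasurePreserving (fun u : ℝ => k - u) volume volume :=
    Measure.measurePreserving_sub_left volume k
  have hH := (memLp_cauchyKernel_mul_one_add_abs hc).comp_measurePreserving mp
  obtain ⟨hfc, C, hC⟩ := hf
  have hC0 : 0 ≤ C := nonneg_of_mul_nonneg_left ((abs_nonneg _).trans (hC 0)) (by positivity)
  refine (hH.const_mul (2 * (C * (1 + |k|)))).mono'
    ((linearGrowth_dressedKernel hc hlin hθ k).1.mul hfc).aestronglyMeasurable
    (.of_forall fun u => ?_)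
  have h1 : 1 + |u| ≤ (1 + |k|) * (1 + |k - u|) := by
    have : |u| ≤ |k| + |k - u| := by
      have := abs_sub_abs_le_abs_sub u k
      rw [abs_sub_comm] at this
      linarith
    nlinarith [mul_nonneg (abs_nonneg k) (abs_nonneg (k - u))]
  rw [norm_mul]
  refine (mul_le_mul (abs_dressedKernel_le hc hlin hφ hθ k u)
    ((hC u).trans (mul_le_mul_of_nonneg_left h1 hC0)) (abs_nonneg _)
    (mul_nonneg zero_le_two (cauchyKernel_pos hc _).le)).trans_eq ?_
  simp only [Function.comp_apply]
  rw [cauchyKernel_sub_comm c u k]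
  ring

/-- The inverse of `1 - T θ` is differentiable in `θ`; the variation in direction `η` solves a
dressing equation with source `-𝒦(η Uf)`, and `R_k` is the kernel of its solution. -/
theorem hasFunctionalDerivAt_dress (hθ : A * ‖θ‖ < 1 / 2) {f : ℝ → ℝ} (hf : LinearGrowth f)
    (k : ℝ) :
    HasFunctionalDerivAt (fun ϑ => dress c ϑ f k)
      (fun u => dressedKernel c θ k u * dress c θ f u) θ := by
  have hfd := linearGrowth_dress hc hlin hθ.le hf
  have hr := linearGrowth_dressedKernel hc hlin hθ.le k
  refine ⟨hr.1.mul hfd.1, memLp_dressedKernel_mul hc hlin hφ hθ.le hfd k, ?_⟩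
  obtain ⟨hfc, C, hC⟩ := linearGrowth_iff.1 hf
  set T := (hlin 0).operator hc with hT
  set F := (hlin 0).normalize hfc C hC with hF
  obtain ⟨D, hD, hDη⟩ := exists_hasFDerivAt_inverse_one_sub T
    ((hlin 0).isUnit_one_sub hc hθ.le) F (BoundedContinuousFunction.evalCLM ℝ k)
  have d3 := hD.const_mul (1 + |k - 0|)
  have hev : (fun ϑ => dress c ϑ f k) =ᶠ[nhds θ] fun ϑ =>
      (1 + |k - 0|) * Ring.inverse (1 - T ϑ) F k := by
    have : ∀ᶠ ϑ : TargetSpace in nhds θ, A * ‖ϑ‖ < 1 / 2 :=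
      (by fun_prop : Continuous fun ϑ : TargetSpace => A * ‖ϑ‖).continuousAt.eventually_lt
        continuousAt_const hθ
    filter_upwards [this] with ϑ hϑ
    exact dress_apply hc hlin hϑ.le hfc hC k
  rw [hasGradientAt_iff_hasFDerivAt]
  refine (d3.congr_of_eventuallyEq hev).congr_fderiv ?_
  ext η
  set g := Ring.inverse (1 - T θ) F with hg
  have hgf : (fun u => (1 + |u - 0|) * g u) = dress c θ f := by
    funext u; exact (dress_apply hc hlin hθ.le hfc hC u).symm
  set G := Ring.inverse (1 - T θ) (T η g) with hG
  -- The linearised equation, with the conjugation by the weight undone.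
  have hGsolve : ∀ u, (1 + |u - 0|) * G u = cauchyConv c η (dress c θ f) u +
      cauchyConv c θ (fun u => (1 + |u - 0|) * G u) u := fun u => by
    have h := DFunLike.congr_fun ((hlin 0).inverse_solves hc hθ.le (T η g)) u
    have hu := ((hlin 0).pos u).ne'
    rw [← hT, ← hG, BoundedContinuousFunction.add_apply, hT, DressingWeight.operator_apply,
      DressingWeight.operator_apply, DressingWeight.conjugate_apply,
      DressingWeight.conjugate_apply, hgf] at h
    rw [h]
    field_simp
  have hmain := eq_integral_dressedKernel hc hlin hφ hθ.le hfd
    (linearGrowth_iff.2 ⟨(hlin 0).continuous_mul G, _, (hlin 0).abs_mul_le G⟩) hGsolve k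
  rw [InnerProductSpace.toDual_apply_apply, L2.inner_def]
  trans (1 + |k - 0|) * G k
  · simp [hG, hg, hDη]
  · rw [hmain]
    refine integral_congr_ae ?_
    filter_upwards [(memLp_dressedKernel_mul hc hlin hφ hθ.le hfd k).coeFn_toLp] with u hu
    rw [hu]
    simp
    ring

end

/-! ### Functional derivatives of products and quotients -/

/-- Common core of the product and quotient rules: a linear combination of gradients keeps a
continuous `L²` representative. -/
theorem HasFunctionalDerivAt.of_hasFDerivAt {F G H : TargetSpace → ℝ} {f g : ℝ → ℝ}
    {θ : TargetSpace} (hf : HasFunctionalDerivAt F f θ) (hg : HasFunctionalDerivAt G g θ) {a b : ℝ}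
    (h : ∀ F' G' : TargetSpace →L[ℝ] ℝ, HasFDerivAt F F' θ → HasFDerivAt G G' θ →
      HasFDerivAt H (a • F' + b • G') θ) :
    HasFunctionalDerivAt H (fun u => a * f u + b * g u) θ := by
  obtain ⟨cf, mf, df⟩ := hf
  obtain ⟨cg, mg, dg⟩ := hg
  refine ⟨(cf.const_mul a).add (cg.const_mul b), (mf.const_smul a).add (mg.const_smul b), ?_⟩
  rw [hasGradientAt_iff_hasFDerivAt] at *
  refine (h _ _ df dg).congr_fderiv ?_
  rw [← map_smul, ← map_smul, ← map_add, ← MemLp.toLp_const_smul, ← MemLp.toLp_const_smul,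
    ← MemLp.toLp_add]
  rfl

theorem HasFunctionalDerivAt.mul {F G : TargetSpace → ℝ} {f g : ℝ → ℝ}
    {θ : TargetSpace} (hf : HasFunctionalDerivAt F f θ) (hg : HasFunctionalDerivAt G g θ) :
    HasFunctionalDerivAt (fun ϑ => F ϑ * G ϑ) (fun u => G θ * f u + F θ * g u) θ :=
  hf.of_hasFDerivAt hg fun F' G' hF hG => by
    rw [add_comm]
    exact hF.mul hG

theorem HasFunctionalDerivAt.div {F G : TargetSpace → ℝ} {f g : ℝ → ℝ}
    {θ : TargetSpace} (hf : HasFunctionalDerivAt F f θ) (hg : HasFunctionalDerivAt G g θ)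
    (h0 : G θ ≠ 0) :
    HasFunctionalDerivAt (fun ϑ => F ϑ / G ϑ)
      (fun u => (G θ)⁻¹ * f u + -(F θ / G θ ^ 2) * g u) θ :=
  hf.of_hasFDerivAt hg fun F' G' hF hG => by
    have hinv := (hasDerivAt_inv h0).comp_hasFDerivAt θ hG
    have h := hF.mul hinv
    simp only [div_eq_mul_inv]
    refine h.congr_fderiv ?_
    ext η
    simp
    ring

theorem HasFunctionalDerivAt.congr {F G : TargetSpace → ℝ} {f : ℝ → ℝ}
    {θ : TargetSpace} (hf : HasFunctionalDerivAt F f θ) (h : G =ᶠ[nhds θ] F) :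
    HasFunctionalDerivAt G f θ := by
  obtain ⟨cf, mf, df⟩ := hf
  refine ⟨cf, mf, ?_⟩
  rw [hasGradientAt_iff_hasFDerivAt] at *
  exact df.congr_of_eventuallyEq h

theorem HasFunctionalDerivAt.congr_deriv {F : TargetSpace → ℝ} {f g : ℝ → ℝ}
    {θ : TargetSpace} (hf : HasFunctionalDerivAt F f θ) (h : ∀ u, f u = g u) :
    HasFunctionalDerivAt F g θ :=
  (funext h : f = g) ▸ hf

/-! ### The velocity -/

section

variable {c A : ℝ} (hc : 0 < c) (hone : DressingWeight c A fun _ => 1)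
  (hlin : ∀ l, DressingWeight c A fun u => 1 + |u - l|) {θ : TargetSpace}
include hc hone hlin

theorem abs_dressedMomentum_sub_one_le (hθ : A * ‖θ‖ ≤ 1 / 2) (k : ℝ) :
    |dressedMomentum c θ k - 1| ≤ 2 * (A * ‖θ‖) := by
  have hle := abs_dress_le hc hlin hθ hone (B := 1) (C := 1) (f := fun _ => 1)
    (fun u => by simp) continuous_const (fun u => by simp)
  have h := dress_eq_add hc hlin hθ (linearGrowth_const 1) k
  have h' := hone.abs_cauchyConv_le hc (θ := θ)
    (linearGrowth_dress hc hlin hθ (linearGrowth_const 1)).1 hle k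
  rw [dressedMomentum, h, add_sub_cancel_left]
  linarith

theorem dressedMomentum_pos (hθ : A * ‖θ‖ < 1 / 2) (k : ℝ) : 0 < dressedMomentum c θ k := by
  have h := (abs_le.1 (abs_dressedMomentum_sub_one_le hc hone hlin hθ.le k)).1
  linarith

/-- With `D = E - l P`, the dressing of `u - l`, the sign of `v(k) - v(l)` is that of `(D(k) - D(l))
P(l) - D(l) (P(k) - P(l))`. Centring at `l` makes every bound independent of the position of `l`. -/
theorem velocity_lt_of_le_add_one (h1 : A * ‖θ‖ ≤ 1 / 8) (h2 : A * ‖θ‖ ≤ c / 8) {k l : ℝ}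
    (hlk : l < k) (hkl : k ≤ l + 1) : velocity c θ l < velocity c θ k := by
  have hθ : A * ‖θ‖ ≤ 1 / 2 := by linarith
  have hε : 0 ≤ A * ‖θ‖ := hone.constant_nonneg_mul hc θ
  set ε := A * ‖θ‖ with hεdef
  set P := dressedMomentum c θ with hP
  set E := dressedEnergy c θ with hE
  set D := fun u => E u - l * P u with hD
  have hPdr : IsDressed c θ (fun _ => 1) P := isDressed_dress hc hlin hθ (linearGrowth_const 1)
  have hEdr : IsDressed c θ (fun k => k) E := isDressed_dress hc hlin hθ linearGrowth_id
  have hDdr : IsDressed c θ (fun u => u - l) D := by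
    simpa using hEdr.sub hc hlin (hPdr.const_mul l)
  have hDeq := (isDressed_iff.1 hDdr).2
  have hPeq := (isDressed_iff.1 hPdr).2
  have hDle : ∀ u, |D u| ≤ 2 * (1 + |u - l|) := fun u => by
    have h := abs_dress_le hc hlin hθ (hlin l) (B := 1 + |l|) (C := 1) (f := fun u => u - l)
      (fun u => by
        have := abs_sub u l
        nlinarith [mul_nonneg (abs_nonneg l) (abs_nonneg u)]) (by fun_prop) (fun u => by linarith) u
    rw [hDdr.dress_eq hc hlin hθ (linearGrowth_id.sub (linearGrowth_const l))] at h
    linarith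
  have hPle : ∀ u, |P u| ≤ 2 * 1 := fun u =>
    (abs_dress_le hc hlin hθ hone (B := 1) (C := 1) (f := fun _ => 1)
      (fun u => by simp) continuous_const (fun u => by simp) u).trans_eq (by ring)
  have hd : 0 < k - l := sub_pos.2 hlk
  have hδ : ε / c ≤ 1 / 8 := by rw [div_le_iff₀ hc]; linarith
  have hδ0 : 0 ≤ ε / c := by positivity
  -- The constant `3` bounds `2 + (k - l)`; this is where `k ≤ l + 1` enters.
  have bD : |D k - D l - (k - l)| ≤ 3 * (ε / c) * (k - l) := by
    have h := (hlin l).abs_cauchyConv_sub_le hc (θ := θ) hDdr.1.1 hDle k l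
    rw [← hεdef, sub_self, abs_zero, abs_of_pos hd] at h
    have e : D k - D l - (k - l) = cauchyConv c θ D k - cauchyConv c θ D l := by
      rw [hDeq k, hDeq l]; ring
    rw [e]
    refine h.trans ?_
    have e2 : 1 / (2 * c) * (k - l) * (2 * ε * (1 + (k - l) + (1 + 0))) =
      (2 + (k - l)) * (ε / c) * (k - l) := by field_simp; ring
    rw [e2]
    gcongr
    linarith
  have bP : |P k - P l| ≤ 2 * (ε / c) * (k - l) := by
    have h := hone.abs_cauchyConv_sub_le hc (θ := θ) hPdr.1.1 hPle k l
    rw [← hεdef, abs_of_pos hd] at h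
    have e : P k - P l = cauchyConv c θ P k - cauchyConv c θ P l := by
      rw [hPeq k, hPeq l]; ring
    rw [e]
    refine h.trans_eq ?_
    field_simp
    ring
  have bDl : |D l| ≤ 2 := by simpa using hDle l
  have bPl : 3 / 4 ≤ P l := by
    have h := (abs_le.1 (abs_dressedMomentum_sub_one_le hc hone hlin hθ l)).1
    rw [← hP] at h
    linarith
  have hPk : 0 < P k := dressedMomentum_pos hc hone hlin (by linarith) k
  have hPl : 0 < P l := by linarith
  have key : 0 < (D k - D l) * P l - D l * (P k - P l) := by
    have g1 : 5 / 8 * (k - l) ≤ D k - D l := by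
      have := (abs_le.1 bD).1
      nlinarith
    have g2 : 5 / 8 * (k - l) * (3 / 4) ≤ (D k - D l) * P l :=
      mul_le_mul g1 bPl (by norm_num) (by nlinarith)
    -- The source `u - l` vanishes at `l`, so only the convolution term, of size at most `2ε`,
    -- remains.
    have bDl' : |D l| ≤ 1 / 4 := by
      have h := (hlin l).abs_cauchyConv_le hc (θ := θ) hDdr.1.1 hDle l
      rw [hDeq l]
      simp only [sub_self, abs_zero, zero_add, ← hεdef] at h ⊢
      linarith
    have g3 : D l * (P k - P l) ≤ 1 / 4 * (1 / 4 * (k - l)) := by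
      refine (le_abs_self _).trans ?_
      rw [abs_mul]
      refine mul_le_mul bDl' (bP.trans ?_) (abs_nonneg _) (by norm_num)
      nlinarith
    linarith
  rw [velocity, velocity, ← hE, ← hP, div_lt_div_iff₀ hPl hPk]
  simp only [hD] at key
  linarith

theorem strictMono_velocity (h1 : A * ‖θ‖ ≤ 1 / 8) (h2 : A * ‖θ‖ ≤ c / 8) :
    StrictMono (velocity c θ) := by
  intro l k hlk
  obtain ⟨n, hn⟩ := exists_nat_gt (k - l)
  have hd : 0 < k - l := sub_pos.2 hlk
  have hn0 : (0 : ℝ) < n := hd.trans hn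
  -- A long interval is cut into `n` steps of length at most `1`.
  have hmono : StrictMono fun i : ℕ => velocity c θ (l + i * ((k - l) / n)) := by
    refine strictMono_nat_of_lt_succ fun i => ?_
    have hs : (k - l) / n ≤ 1 := (div_le_one hn0).2 hn.le
    have hs0 : 0 < (k - l) / n := by positivity
    apply velocity_lt_of_le_add_one hc hone hlin h1 h2 <;> push_cast <;> linarith
  have h := hmono (Nat.cast_pos.1 hn0)
  simpa [mul_div_cancel₀ (k - l) hn0.ne'] using h

end

/-! ### Functional derivatives of the velocity and of the Tsarev coefficients -/

section

variable {c A : ℝ} (hc : 0 < c) (hone : DressingWeight c A fun _ => 1)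
  (hlin : ∀ l, DressingWeight c A fun u => 1 + |u - l|)
  (hφ : ∀ l, DressingWeight c A fun u => cauchyKernel c (u - l)) {θ : TargetSpace}
include hc hone hlin hφ

theorem hasFunctionalDerivAt_velocity (hθ : A * ‖θ‖ < 1 / 2) (k : ℝ) :
    HasFunctionalDerivAt (fun ϑ => velocity c ϑ k)
      (fun u => (velocity c θ u - velocity c θ k) *
        (dressedKernel c θ k u * dressedMomentum c θ u / dressedMomentum c θ k)) θ := by
  have hP := dressedMomentum_pos hc hone hlin hθ
  have h := (hasFunctionalDerivAt_dress hc hlin hφ hθ linearGrowth_id k).div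
    (hasFunctionalDerivAt_dress hc hlin hφ hθ (linearGrowth_const 1) k) (hP k).ne'
  refine h.congr_deriv fun u => ?_
  have hk := (hP k).ne'
  have hu := (hP u).ne'
  simp only [velocity, dressedMomentum, dressedEnergy] at *
  field_simp
  ring

theorem tsarevCoeff_eq (hθ : A * ‖θ‖ < 1 / 8) (hθ' : A * ‖θ‖ < c / 8) {k k' : ℝ} (hk : k ≠ k') :
    tsarevCoeff c k k' θ =
      dressedKernel c θ k k' * dressedMomentum c θ k' / dressedMomentum c θ k := by
  have hv : velocity c θ k' - velocity c θ k ≠ 0 := sub_ne_zero.2 fun h =>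
    hk ((strictMono_velocity hc hone hlin hθ.le hθ'.le).injective h).symm
  rw [tsarevCoeff,
    (hasFunctionalDerivAt_velocity hc hone hlin hφ (by linarith) k).functionalDeriv_eq,
    one_div, inv_mul_cancel_left₀ hv]

theorem hasFunctionalDerivAt_tsarevCoeff (hθ : A * ‖θ‖ < 1 / 8) (hθ' : A * ‖θ‖ < c / 8) {k k' : ℝ}
    (hk : k ≠ k') :
    HasFunctionalDerivAt (tsarevCoeff c k k')
      (fun u => (dressedKernel c θ k' u * dressedKernel c θ k u * dressedMomentum c θ k' +
          dressedKernel c θ k k' * dressedKernel c θ k' u * dressedMomentum c θ u) /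
            dressedMomentum c θ k -
        dressedKernel c θ k k' * dressedMomentum c θ k' * dressedKernel c θ k u *
          dressedMomentum c θ u / dressedMomentum c θ k ^ 2) θ := by
  have hθ2 : A * ‖θ‖ < 1 / 2 := by linarith
  have hP := (dressedMomentum_pos hc hone hlin hθ2 k).ne'
  -- The strict smallness conditions are open, so the closed form holds near `θ` and may be
  -- differentiated.
  have hev : tsarevCoeff c k k' =ᶠ[nhds θ] fun ϑ =>
      dressedKernel c ϑ k k' * dressedMomentum c ϑ k' / dressedMomentum c ϑ k := by
    have hcont : ContinuousAt (fun ϑ : TargetSpace => A * ‖ϑ‖) θ := by fun_prop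
    filter_upwards [hcont.eventually_lt continuousAt_const hθ,
      hcont.eventually_lt continuousAt_const hθ'] with ϑ h1 h2
    exact tsarevCoeff_eq hc hone hlin hφ h1 h2 hk
  have dP := fun l => hasFunctionalDerivAt_dress hc hlin hφ hθ2 (linearGrowth_const 1) l
  have dR := hasFunctionalDerivAt_dress hc hlin hφ hθ2 (linearGrowth_cauchyKernel hc k) k'
  refine (((dR.mul (dP k')).div (dP k) hP).congr hev).congr_deriv fun u => ?_
  simp only [dressedMomentum, dressedKernel] at *
  field_simp
  ring

end

end BetheBoltzmann

open BetheBoltzmann in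
theorem mainTheorem10 (c : ℝ) (hc : 0 < c) :
    ∃ 𝒜 : Set BetheBoltzmann.TargetSpace, IsOpen 𝒜 ∧ 0 ∈ 𝒜 ∧
      -- the system is well defined on `𝒜`
      (∀ θ ∈ 𝒜, BetheBoltzmann.DressingExists c θ ∧
        (∀ k, 0 < BetheBoltzmann.dressedMomentum c θ k) ∧
        (∀ k k', k ≠ k' → BetheBoltzmann.velocity c θ k ≠ BetheBoltzmann.velocity c θ k')) ∧
      -- continuum linear degeneracy
      (∀ θ ∈ 𝒜, ∀ k,
        BetheBoltzmann.FunctionallyDifferentiableAt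
          (fun ϑ => BetheBoltzmann.velocity c ϑ k) θ ∧
        BetheBoltzmann.functionalDeriv (fun ϑ => BetheBoltzmann.velocity c ϑ k) θ k = 0) ∧
      -- continuum semi-Hamiltonian property
      (∀ θ ∈ 𝒜, ∀ k k' k'', k ≠ k' → k' ≠ k'' → k'' ≠ k →
        BetheBoltzmann.FunctionallyDifferentiableAt (BetheBoltzmann.tsarevCoeff c k k') θ ∧
        BetheBoltzmann.FunctionallyDifferentiableAt (BetheBoltzmann.tsarevCoeff c k k'') θ ∧
        BetheBoltzmann.functionalDeriv (BetheBoltzmann.tsarevCoeff c k k') θ k'' =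
          BetheBoltzmann.functionalDeriv (BetheBoltzmann.tsarevCoeff c k k'') θ k') := by
  obtain ⟨A, hA, hone, hlin, hφ⟩ := exists_dressingWeight hc
  have hcont : Continuous fun θ : TargetSpace => A * ‖θ‖ := by fun_prop
  -- Both bounds serve strict monotonicity of `v`: `1 / 8` controls the sizes of `P` and `D`, and `c
  -- / 8` their increments.
  refine ⟨{θ | A * ‖θ‖ < 1 / 8} ∩ {θ | A * ‖θ‖ < c / 8},
    (isOpen_lt hcont continuous_const).inter (isOpen_lt hcont continuous_const),
    ⟨by simp, by simpa using hc⟩, ?_, ?_, ?_⟩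
  · rintro θ ⟨h1, h2⟩
    simp only [Set.mem_ofPred_eq] at h1 h2
    exact ⟨dressingExists hc hlin (by linarith), dressedMomentum_pos hc hone hlin (by linarith),
      fun k k' hk => (strictMono_velocity hc hone hlin h1.le h2.le).injective.ne hk⟩
  · rintro θ ⟨h1, h2⟩ k
    simp only [Set.mem_ofPred_eq] at h1
    have h := hasFunctionalDerivAt_velocity hc hone hlin hφ (θ := θ) (by linarith) k
    refine ⟨⟨_, h⟩, ?_⟩
    simp [h.functionalDeriv_eq]
  · rintro θ ⟨h1, h2⟩ k k' k'' hk - hk''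
    simp only [Set.mem_ofPred_eq] at h1 h2
    have h := hasFunctionalDerivAt_tsarevCoeff hc hone hlin hφ h1 h2 hk
    have h' := hasFunctionalDerivAt_tsarevCoeff hc hone hlin hφ h1 h2 hk''.symm
    refine ⟨⟨_, h⟩, ⟨_, h'⟩, ?_⟩
    rw [h.functionalDeriv_eq, h'.functionalDeriv_eq]
    -- Once `R_k''(k')` is replaced by `R_k'(k'')`, exchanging `k'` and `k''` only permutes the
    -- terms.
    simp only [dressedKernel_symm hc hlin hφ (by linarith : A * ‖θ‖ ≤ 1 / 2) k'' k']
    ring
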